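/- For a positive integer $N$ and a symmetric set $C\subseteq \mathbb{Z}_N\setminus\{0\}$ (that is, $x\in C \iff -x\in C$), let $X(\mathbb{Z}_N,C)$ be the circulant graph with vertex set $\mathbb{Z}_N$ in which $u,v$ are adjacent iff $v-u\in C$. Write $L_G$ for the Laplacian matrix of a graph $G$ and $\preccurlyeq$ for the Loewner order on real symmetric matrices. The effective resistance between vertices $u,v$ of $G$ is $(\chi_u-\chi_v)^\top L_G^{\dagger}(\chi_u-\chi_v)$, where $\chi_u$ is the indicator vector of $u$ and $L_G^\dagger$ is the pseudoinverse of $L_G$. Logarithms are to base $6$. There exist a constant $c>0$, a constant $K_0$, and a function $h$, assigning a positive integer $h(K,a_1,\ldots,a_K)$ to each positive integer $K$ and positive integers $a_1,\ldots,a_K$, such that the following holds for every integer $K>K_0$. Let $a_1,\ldots,a_K$ be positive integers satisfying \[ \frac{a_k}{a_1+\cdots+a_{k-1}} > 4\log_6 K \qquad \text{for all } k=2,\ldots,K, \] and let $N>h(K,a_1,\ldots,a_K)$ be an integer such that $C=\{\pm a_1,\ldots,\pm a_K\} \pmod N$ generates the group $\mathbb{Z}_N$. Let $X=X(\mathbb{Z}_N,C)$,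 and let $\alpha$ be the maximum, over the edges of $X$, of the effective resistance in $X$ between the two endpoints of the edge. Then no partition of $C$ into symmetric subsets $C_1\cup C_2$ satisfies \[ \Bigl(\tfrac12-c\sqrt{\alpha\log_6 K}\Bigr)L_X \preccurlyeq L_{X(\mathbb{Z}_N,C_i)} \preccurlyeq \Bigl(\tfrac12+c\sqrt{\alpha\log_6 K}\Bigr)L_X \qquad \text{for both } i\in\{1,2\}. \] (The statement with natural logarithms follows, since $\ln K\ge\log_6 K$ and the base only rescales $c$ in the conclusion.) -/

import Mathlib

open scoped MatrixOrder

namespace CirculantLower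

/-- The pseudoinverse `∑ λᵢ⁻¹ vᵢ vᵢᵀ` over the nonzero eigenvalues of a real symmetric matrix, the `vᵢ`
being orthonormal eigenvectors; the zero eigenvalues contribute nothing since `0⁻¹ = 0`. -/
noncomputable def pseudoinverse {V : Type*} [Fintype V] [DecidableEq V] {A : Matrix V V ℝ}
    (hA : A.IsHermitian) : Matrix V V ℝ :=
  ∑ i, (hA.eigenvalues i)⁻¹ •
    Matrix.vecMulVec (⇑(hA.eigenvectorBasis i)) (⇑(hA.eigenvectorBasis i))

open Classical in
/-- The Laplacian matrix of a finite graph. -/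
noncomputable def laplacian {V : Type*} [Fintype V] [DecidableEq V] (G : SimpleGraph V) :
    Matrix V V ℝ :=
  G.lapMatrix ℝ

theorem isHermitian_laplacian {V : Type*} [Fintype V] [DecidableEq V] (G : SimpleGraph V) :
    (laplacian G).IsHermitian := by
  classical
  exact G.isHermitian_lapMatrix ℝ

/-- The effective resistance `(χ_u - χ_v)ᵀ L_G† (χ_u - χ_v)` between two vertices. -/
noncomputable def effectiveResistance {V : Type*} [Fintype V] [DecidableEq V] (G : SimpleGraph V)
    (u v : V) : ℝ :=
  (Pi.single u 1 - Pi.single v 1 : V → ℝ) ⬝ᵥ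
    (Matrix.mulVec (pseudoinverse (isHermitian_laplacian G)) (Pi.single u 1 - Pi.single v 1))

/-- The maximum effective resistance between the endpoints of an edge (a supremum over a finite set,
hence a maximum as soon as the graph has an edge). -/
noncomputable def maxEdgeResistance {V : Type*} [Fintype V] [DecidableEq V] (G : SimpleGraph V) : ℝ :=
  sSup {r : ℝ | ∃ u v : V, G.Adj u v ∧ r = effectiveResistance G u v}

/-- The set `{±a₁, …, ±a_K}` modulo `N`. -/
def generators {K : ℕ} (N : ℕ) (a : Fin K → ℕ) : Set (ZMod N) :=
  {x | ∃ k, x = (a k : ZMod N) ∨ x = -(a k : ZMod N)}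

/-- A set is symmetric if it contains `x` exactly when it contains `-x`. -/
def IsSymmetricSet {M : Type*} [AddGroup M] (S : Set M) : Prop :=
  ∀ x, x ∈ S ↔ -x ∈ S

/-- `(1/2 - ε) L_G ≼ L_H ≼ (1/2 + ε) L_G` in the Loewner order. -/
def HalfApproximates {V : Type*} [Fintype V] [DecidableEq V] (H G : SimpleGraph V) (ε : ℝ) : Prop :=
  (1 / 2 - ε) • laplacian G ≤ laplacian H ∧ laplacian H ≤ (1 / 2 + ε) • laplacian G

end CirculantLower

/-!
The eigenvalues of the Laplacian of a circulant graph `X(ℤ/N, C)` are `∑ x ∈ C, (1 - Re ψ x)` up to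
normalisation, where `ψ` runs over the characters of `ℤ/N`. Because the `aₖ` grow by a factor of at
least `8` and `N` is large, some character has all the phases of `ψ aₖ` within `1/6` of a turn of
prescribed targets (`exists_near_targets`, `exists_int_div_near_targets`). Prescribing half a turn on
the larger part `S` of the partition and zero on the smaller part `T` gives `1 - Re ψ ≥ 3/2` on `S`
and `1 - Re ψ ≤ 1/2` on `T`, so that `S` carries at least `3/4` of the corresponding eigenvalue of
the whole graph. Hence no partition achieves `L_{X(S)} ≼ (1/2 + ε) L_X` with `ε < 1/4`.

It remains to see that `c √(α log₆ K) < 1/4` for a small constant `c`. In a Cayley graph of an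
abelian group the endpoints `u`, `u + a` of an edge are joined, for every `b ∈ C`, by the path
`u, u + b, u + b + a, u + a`; averaging over `b` gives `|C| (f u - f (u + a))² ≤ 18 fᵀ L f`
(`card_mul_sq_sub_le`), which dualises to `α ≤ 18 / |C|` (`maxEdgeResistance_circulantGraph_le`).
As `|C| ≥ K`, the product `α log₆ K` is bounded.
-/

namespace CirculantLower

open Matrix

/-! ### Effective resistance and the Dirichlet form -/

/-- The relation `L† L L† = L†`, as an identity between quadratic forms. -/
theorem dotProduct_mulVec_pseudoinverse {V : Type*} [Fintype V] [DecidableEq V]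
    {A : Matrix V V ℝ} (hA : A.IsHermitian) (x : V → ℝ) :
    (pseudoinverse hA *ᵥ x) ⬝ᵥ (A *ᵥ (pseudoinverse hA *ᵥ x)) =
      x ⬝ᵥ (pseudoinverse hA *ᵥ x) := by
  have horth : ∀ i j, (⇑(hA.eigenvectorBasis i) : V → ℝ) ⬝ᵥ ⇑(hA.eigenvectorBasis j) =
      if i = j then 1 else 0 := by
    intro i j
    have h := orthonormal_iff_ite.mp hA.eigenvectorBasis.orthonormal j i
    rw [EuclideanSpace.inner_eq_star_dotProduct] at h
    simpa [eq_comm] using h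
  have hpinv : pseudoinverse hA *ᵥ x = ∑ i, ((hA.eigenvalues i)⁻¹ *
      ((⇑(hA.eigenvectorBasis i) : V → ℝ) ⬝ᵥ x)) • (⇑(hA.eigenvectorBasis i) : V → ℝ) := by
    simp only [pseudoinverse, sum_mulVec, smul_mulVec, vecMulVec_mulVec]
    refine Finset.sum_congr rfl fun i _ => ?_
    ext v
    simp only [Pi.smul_apply, smul_eq_mul, MulOpposite.smul_eq_mul_unop, MulOpposite.unop_op]
    ring
  rw [hpinv]
  simp only [mulVec_sum, mulVec_smul, hA.mulVec_eigenvectorBasis, dotProduct_sum, sum_dotProduct,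
    smul_dotProduct, dotProduct_smul, horth, smul_eq_mul]
  refine Finset.sum_congr rfl fun i _ => ?_
  simp only [mul_ite, mul_one, mul_zero, Finset.sum_ite_eq', Finset.mem_univ, if_true]
  rw [dotProduct_comm x]
  rcases eq_or_ne (hA.eigenvalues i) 0 with h | h
  · simp [h]
  · field_simp

/-- The variational upper bound for the effective resistance: a Poincaré inequality for the pair
`u`, `v` bounds the resistance between `u` and `v` by its constant. -/
theorem effectiveResistance_le {V : Type*} [Fintype V] [DecidableEq V] (G : SimpleGraph V)
    {u v : V} {B : ℝ} (hB : 0 ≤ B)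
    (h : ∀ f : V → ℝ, (f u - f v) ^ 2 ≤ B * (f ⬝ᵥ (laplacian G *ᵥ f))) :
    effectiveResistance G u v ≤ B := by
  have hf := h (pseudoinverse (isHermitian_laplacian G) *ᵥ (Pi.single u 1 - Pi.single v 1))
  rw [dotProduct_mulVec_pseudoinverse] at hf
  have hr : effectiveResistance G u v =
      (pseudoinverse (isHermitian_laplacian G) *ᵥ (Pi.single u 1 - Pi.single v 1)) u -
      (pseudoinverse (isHermitian_laplacian G) *ᵥ (Pi.single u 1 - Pi.single v 1)) v := by
    simp [effectiveResistance, sub_dotProduct, single_dotProduct]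
  rw [← hr] at hf
  change effectiveResistance G u v ^ 2 ≤ B * effectiveResistance G u v at hf
  by_contra! hlt
  nlinarith

/-! ### Circulant graphs over a finite abelian group -/

section AbelianGroup

variable {G : Type*} [AddCommGroup G] [Fintype G] [DecidableEq G]

theorem dotProduct_laplacian_circulantGraph {S : Finset G} (hS : IsSymmetricSet (S : Set G))
    (f : G → ℝ) :
    f ⬝ᵥ (laplacian (SimpleGraph.circulantGraph (S : Set G)) *ᵥ f) =
      (∑ u, ∑ s ∈ S, (f u - f (u + s)) ^ 2) / 2 := by
  classical
  rw [laplacian, ← toLinearMap₂'_apply', SimpleGraph.lapMatrix_toLinearMap₂']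
  congr 1
  refine Finset.sum_congr rfl fun u _ => ?_
  rw [← Equiv.sum_comp (Equiv.addLeft u), ← Finset.univ_inter S, ← Finset.sum_ite_mem]
  refine Finset.sum_congr rfl fun s _ => ?_
  have hneg : -s ∈ S ↔ s ∈ S := (hS s).symm
  rcases eq_or_ne s 0 with rfl | hs
  · simp
  · simp [SimpleGraph.circulantGraph_adj, hs, hneg]

theorem card_mul_sq_sub_le {C : Finset G} (hC : IsSymmetricSet (C : Set G)) {u v : G}
    (huv : (SimpleGraph.circulantGraph (C : Set G)).Adj u v) (f : G → ℝ) :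
    (C.card : ℝ) * (f u - f v) ^ 2 ≤
      18 * (f ⬝ᵥ (laplacian (SimpleGraph.circulantGraph (C : Set G)) *ᵥ f)) := by
  obtain ⟨a, ha, rfl⟩ : ∃ a ∈ C, u + a = v := by
    refine ⟨v - u, ?_, by abel⟩
    rw [SimpleGraph.circulantGraph_adj] at huv
    rcases huv.2 with h | h
    · have := (hC _).mp h
      simpa using this
    · simpa using h
  rw [dotProduct_laplacian_circulantGraph hC]
  set E := ∑ u, ∑ s ∈ C, (f u - f (u + s)) ^ 2 with hE
  have hstar : ∀ w, ∑ s ∈ C, (f w - f (w + s)) ^ 2 ≤ E := fun w =>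
    Finset.single_le_sum (f := fun w => ∑ s ∈ C, (f w - f (w + s)) ^ 2)
      (fun _ _ => Finset.sum_nonneg fun _ _ => sq_nonneg _) (Finset.mem_univ w)
  have hpar : ∑ b ∈ C, (f (u + b) - f (u + b + a)) ^ 2 ≤ E := by
    calc ∑ b ∈ C, (f (u + b) - f (u + b + a)) ^ 2
        ≤ ∑ b, (f (u + b) - f (u + b + a)) ^ 2 :=
          Finset.sum_le_sum_of_subset_of_nonneg (Finset.subset_univ _) fun _ _ _ => sq_nonneg _
      _ = ∑ w, (f w - f (w + a)) ^ 2 :=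
          Equiv.sum_comp (Equiv.addLeft u) fun w => (f w - f (w + a)) ^ 2
      _ ≤ E := Finset.sum_le_sum fun w _ =>
          Finset.single_le_sum (f := fun s => (f w - f (w + s)) ^ 2) (fun _ _ => sq_nonneg _) ha
  calc (C.card : ℝ) * (f u - f (u + a)) ^ 2 = ∑ b ∈ C, (f u - f (u + a)) ^ 2 := by simp
    _ ≤ ∑ b ∈ C, 3 * ((f u - f (u + b)) ^ 2 + (f (u + b) - f (u + b + a)) ^ 2 +
          (f (u + a) - f (u + a + b)) ^ 2) := by
        refine Finset.sum_le_sum fun b _ => ?_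
        rw [add_right_comm u a b]
        nlinarith [sq_nonneg (f u - f (u + b) - (f (u + b) - f (u + b + a))),
          sq_nonneg (f (u + b) - f (u + b + a) - (f (u + b + a) - f (u + a))),
          sq_nonneg (f u - f (u + b) - (f (u + b + a) - f (u + a)))]
    _ ≤ 18 * (E / 2) := by
        rw [← Finset.mul_sum, Finset.sum_add_distrib, Finset.sum_add_distrib]
        linarith [hstar u, hstar (u + a)]

theorem maxEdgeResistance_circulantGraph_le {C : Finset G} (hC : IsSymmetricSet (C : Set G))
    (hpos : 0 < C.card) :
    maxEdgeResistance (SimpleGraph.circulantGraph (C : Set G)) ≤ 18 / C.card := by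
  have hcard : (0 : ℝ) < C.card := by exact_mod_cast hpos
  refine Real.sSup_le ?_ (by positivity)
  rintro r ⟨u, v, huv, rfl⟩
  refine effectiveResistance_le _ (by positivity) fun f => ?_
  rw [div_mul_eq_mul_div, le_div_iff₀ hcard, mul_comm]
  exact card_mul_sq_sub_le hC huv f

/-- The Dirichlet forms of the real and imaginary parts of a character add up to its eigenvalue
times the order of the group. -/
theorem sum_dirichlet_addChar {S : Finset G} (hS : IsSymmetricSet (S : Set G))
    (ψ : AddChar G ℂ) :
    (fun u => (ψ u).re) ⬝ᵥ (laplacian (SimpleGraph.circulantGraph (S : Set G)) *ᵥ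
        fun u => (ψ u).re) +
      (fun u => (ψ u).im) ⬝ᵥ (laplacian (SimpleGraph.circulantGraph (S : Set G)) *ᵥ
        fun u => (ψ u).im) =
      Fintype.card G * ∑ s ∈ S, (1 - (ψ s).re) := by
  have hnorm : ∀ x, (ψ x).re ^ 2 + (ψ x).im ^ 2 = 1 := fun x => by
    have h : ‖ψ x‖ = 1 := AddChar.norm_apply ψ x
    have h2 := Complex.sq_norm (ψ x)
    rw [h, Complex.normSq_apply] at h2
    linarith
  have hterm : ∀ u s, ((ψ u).re - (ψ (u + s)).re) ^ 2 + ((ψ u).im - (ψ (u + s)).im) ^ 2 =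
      2 * (1 - (ψ s).re) := fun u s => by
    rw [AddChar.map_add_eq_mul, Complex.mul_re, Complex.mul_im]
    linear_combination (1 - 2 * (ψ s).re + (ψ s).re ^ 2 + (ψ s).im ^ 2) * hnorm u + hnorm s
  rw [dotProduct_laplacian_circulantGraph hS, dotProduct_laplacian_circulantGraph hS, ← add_div,
    ← Finset.sum_add_distrib]
  simp only [← Finset.sum_add_distrib, hterm, ← Finset.mul_sum]
  simp only [Finset.sum_const, Finset.card_univ, nsmul_eq_mul]
  ring

/-- A Loewner inequality between Laplacians of circulant graphs, tested on a character. -/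
theorem sum_one_sub_re_le_of_laplacian_le {S C : Finset G} (hS : IsSymmetricSet (S : Set G))
    (hC : IsSymmetricSet (C : Set G)) {t : ℝ}
    (h : laplacian (SimpleGraph.circulantGraph (S : Set G)) ≤
      t • laplacian (SimpleGraph.circulantGraph (C : Set G))) (ψ : AddChar G ℂ) :
    ∑ s ∈ S, (1 - (ψ s).re) ≤ t * ∑ s ∈ C, (1 - (ψ s).re) := by
  have hquad : ∀ f : G → ℝ,
      f ⬝ᵥ (laplacian (SimpleGraph.circulantGraph (S : Set G)) *ᵥ f) ≤
        t * (f ⬝ᵥ (laplacian (SimpleGraph.circulantGraph (C : Set G)) *ᵥ f)) := fun f => by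
    have h1 := (Matrix.le_iff.mp h).dotProduct_mulVec_nonneg f
    rw [star_trivial, sub_mulVec, dotProduct_sub, smul_mulVec, dotProduct_smul, smul_eq_mul] at h1
    linarith
  have hcard : (0 : ℝ) < Fintype.card G := by exact_mod_cast Fintype.card_pos
  refine le_of_mul_le_mul_left ?_ hcard
  rw [mul_left_comm, ← sum_dirichlet_addChar hS, ← sum_dirichlet_addChar hC, mul_add]
  exact add_le_add (hquad _) (hquad _)

end AbelianGroup

/-! ### Simultaneous approximation for lacunary sequences -/

/-- If `a` grows by a factor of at least `8`, a single `φ` brings the phases `aₖ φ` within `1/14` of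
arbitrary targets modulo `1`. The summand `a k / (14 * a n)` is the room that the corrections made
for the later terms of the sequence will use up. -/
theorem exists_near_targets (a t : ℕ → ℝ) (ha : ∀ k, 0 < a k) (n : ℕ)
    (hlac : ∀ k < n, 8 * a k ≤ a (k + 1)) :
    ∃ φ : ℝ, ∀ k ≤ n, ∃ m : ℤ, |a k * φ - t k - m| ≤ 1 / 14 - a k / (14 * a n) := by
  induction n with
  | zero =>
    have := ha 0
    refine ⟨t 0 / a 0, fun k hk => ⟨0, ?_⟩⟩
    obtain rfl : k = 0 := by omega
    have h1 : a 0 * (t 0 / a 0) - t 0 - ((0 : ℤ) : ℝ) = 0 := by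
      push_cast; field_simp; ring
    have h2 : a 0 / (14 * a 0) = 1 / 14 := by field_simp
    rw [h1, h2]; simp
  | succ n ih =>
    obtain ⟨φ, hφ⟩ := ih fun k hk => hlac k (by omega)
    have hn := ha n
    have hn1 := ha (n + 1)
    -- `x` is the phase error of the new term, corrected by moving `φ` by at most `1 / (2 * a (n+1))`
    set x := a (n + 1) * φ - t (n + 1) with hx
    have hround : |x - round x| ≤ 1 / 2 := abs_sub_round x
    refine ⟨φ - (x - round x) / a (n + 1), fun k hk => ?_⟩
    rcases Nat.lt_or_ge n k with hk' | hk'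
    · obtain rfl : k = n + 1 := by omega
      refine ⟨round x, ?_⟩
      have h1 : a (n + 1) * (φ - (x - round x) / a (n + 1)) - t (n + 1) - round x = 0 := by
        rw [hx]; field_simp; ring
      have h2 : a (n + 1) / (14 * a (n + 1)) = 1 / 14 := by field_simp
      rw [h1, h2]; simp
    · obtain ⟨m, hm⟩ := hφ k hk'
      refine ⟨m, ?_⟩
      have hk0 := ha k
      have hshift : |a k * ((x - round x) / a (n + 1))| ≤ a k * ((1 / 2) / a (n + 1)) := by
        rw [abs_mul, abs_div, abs_of_pos hk0, abs_of_pos hn1]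
        gcongr
      have hgrow : 8 / a (n + 1) ≤ 1 / a n := by
        rw [div_le_div_iff₀ hn1 hn]; linarith [hlac n (by omega)]
      have hroom : a k * ((1 / 2) / a (n + 1)) + a k / (14 * a (n + 1)) ≤ a k / (14 * a n) := by
        calc a k * ((1 / 2) / a (n + 1)) + a k / (14 * a (n + 1))
            = a k / 14 * (8 / a (n + 1)) := by field_simp; norm_num
          _ ≤ a k / 14 * (1 / a n) := by gcongr
          _ = a k / (14 * a n) := by field_simp
      calc |a k * (φ - (x - round x) / a (n + 1)) - t k - m|
          = |(a k * φ - t k - m) - a k * ((x - round x) / a (n + 1))| := by ring_nf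
        _ ≤ |a k * φ - t k - m| + |a k * ((x - round x) / a (n + 1))| := abs_sub _ _
        _ ≤ 1 / 14 - a k / (14 * a (n + 1)) := by linarith

/-- The approximation of `exists_near_targets` can be realised by a fraction with denominator `N`,
once `N` is large compared with the terms of the sequence. -/
theorem exists_int_div_near_targets {K : ℕ} (a : Fin K → ℕ) (ha : ∀ k, 0 < a k)
    (hlac : ∀ (k : ℕ) (hk : k + 1 < K), 8 * a ⟨k, by omega⟩ ≤ a ⟨k + 1, hk⟩)
    {N : ℕ} (hN : ∀ k, 6 * a k ≤ N) (t : Fin K → ℝ) :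
    ∃ j : ℤ, ∀ k, ∃ m : ℤ, |a k * (j / N : ℝ) - t k - m| ≤ 1 / 6 := by
  rcases K with _ | n
  · exact ⟨0, fun k => k.elim0⟩
  have hmin : ∀ k : Fin (n + 1), Fin.ofNat (n + 1) (k : ℕ) = k := fun k => by
    ext; simp
  have hmin' : ∀ k (hk : k < n + 1), Fin.ofNat (n + 1) k = ⟨k, hk⟩ := fun k hk => hmin ⟨k, hk⟩
  obtain ⟨φ, hφ⟩ := exists_near_targets (fun k => a (Fin.ofNat (n + 1) k))
    (fun k => t (Fin.ofNat (n + 1) k)) (fun k => by exact_mod_cast ha _) n (fun k hk => by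
      simp only [hmin' k (by omega), hmin' (k + 1) (by omega)]
      exact_mod_cast hlac k (by omega))
  refine ⟨round (φ * N), fun k => ?_⟩
  obtain ⟨m, hm⟩ := hφ k (by omega)
  simp only [hmin] at hm
  refine ⟨m, ?_⟩
  have hak : (0 : ℝ) < a k := by exact_mod_cast ha k
  have hNk : 6 * (a k : ℝ) ≤ N := by exact_mod_cast hN k
  have hN0 : (0 : ℝ) < N := by linarith
  have hroom : 0 ≤ (a k : ℝ) / (14 * a (Fin.ofNat (n + 1) n)) := by positivity
  have hround : |φ * N - round (φ * N)| ≤ 1 / 2 := abs_sub_round _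
  have hshift : |a k * ((φ * N - round (φ * N)) / N)| ≤ 1 / 12 := by
    rw [abs_mul, abs_div, abs_of_pos hak, abs_of_pos hN0, ← mul_div_assoc, div_le_iff₀ hN0]
    nlinarith
  calc |a k * (round (φ * N) / N : ℝ) - t k - m|
      = |(a k * φ - t k - m) - a k * ((φ * N - round (φ * N)) / N)| := by
        congr 1; field_simp; ring
    _ ≤ |a k * φ - t k - m| + |a k * ((φ * N - round (φ * N)) / N)| := abs_sub _ _
    _ ≤ 1 / 6 := by linarith

theorem half_le_cos_two_pi_mul {y : ℝ} {m : ℤ} (h : |y - m| ≤ 1 / 6) :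
    1 / 2 ≤ Real.cos (2 * Real.pi * y) := by
  have hpi := Real.pi_pos
  have h1 : Real.cos (2 * Real.pi * y) = Real.cos |2 * Real.pi * (y - m)| := by
    rw [Real.cos_abs, ← Real.cos_sub_int_mul_two_pi _ m]
    congr 1; ring
  rw [h1, ← Real.cos_pi_div_three, abs_mul, abs_of_pos (by positivity : (0 : ℝ) < 2 * Real.pi)]
  refine Real.cos_le_cos_of_nonneg_of_le_pi (by positivity) (by linarith) ?_
  nlinarith

/-! ### The partition of the generators -/

theorem isSymmetricSet_generators {K : ℕ} (N : ℕ) (a : Fin K → ℕ) :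
    IsSymmetricSet (generators N a) := by
  intro x
  simp only [generators, Set.mem_ofPred_eq]
  refine exists_congr fun k => ?_
  rw [neg_eq_iff_eq_neg, neg_inj, or_comm]

/-- A character of `ℤ/N` that is close to `-1` on a symmetric set `S` of generators and close to `1`
on the generators outside `S`. -/
theorem exists_addChar_separating {K : ℕ} (a : Fin K → ℕ) (ha : ∀ k, 0 < a k)
    (hlac : ∀ (k : ℕ) (hk : k + 1 < K), 8 * a ⟨k, by omega⟩ ≤ a ⟨k + 1, hk⟩)
    {N : ℕ} [NeZero N] (hN : ∀ k, 6 * a k ≤ N) {S : Set (ZMod N)} (hS : IsSymmetricSet S) :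
    ∃ ψ : AddChar (ZMod N) ℂ, ∀ x ∈ generators N a,
      (x ∈ S → (ψ x).re ≤ -(1 / 2)) ∧ (x ∉ S → 1 / 2 ≤ (ψ x).re) := by
  classical
  obtain ⟨j, hj⟩ := exists_int_div_near_targets a ha hlac hN
    fun k => if (a k : ZMod N) ∈ S then 1 / 2 else 0
  refine ⟨AddChar.mulShift ZMod.stdAddChar (j : ZMod N), ?_⟩
  have hre : ∀ n : ℤ, (AddChar.mulShift ZMod.stdAddChar (j : ZMod N) (n : ZMod N)).re =
      Real.cos (2 * Real.pi * (n * (j / N : ℝ))) := fun n => by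
    rw [AddChar.mulShift_apply, ← Int.cast_mul, ZMod.stdAddChar_coe]
    have : 2 * (Real.pi : ℂ) * Complex.I * ((j * n : ℤ) : ℂ) / N =
        ((2 * Real.pi * (n * (j / N : ℝ)) : ℝ) : ℂ) * Complex.I := by
      push_cast; ring
    rw [this, Complex.exp_ofReal_mul_I_re]
  have hk : ∀ k, ((a k : ZMod N) ∈ S → Real.cos (2 * Real.pi * (a k * (j / N : ℝ))) ≤ -(1 / 2)) ∧
      ((a k : ZMod N) ∉ S → 1 / 2 ≤ Real.cos (2 * Real.pi * (a k * (j / N : ℝ)))) := fun k => by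
    obtain ⟨m, hm⟩ := hj k
    constructor
    · intro h
      rw [if_pos h] at hm
      have := half_le_cos_two_pi_mul hm
      rw [show 2 * Real.pi * (a k * (j / N : ℝ) - 1 / 2) =
        2 * Real.pi * (a k * (j / N : ℝ)) - Real.pi by ring, Real.cos_sub_pi] at this
      linarith
    · intro h
      rw [if_neg h, sub_zero] at hm
      exact half_le_cos_two_pi_mul hm
  rintro x ⟨k, rfl | rfl⟩
  · have := hre (a k)
    push_cast at this
    rw [this]
    exact hk k
  · have := hre (-(a k))
    push_cast at this
    rw [this, neg_mul, mul_neg, Real.cos_neg, ← hS]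
    exact hk k

/-- The larger part of a partition of the generators carries more than `1/2 + ε` of some eigenvalue
of the whole graph. -/
theorem not_laplacian_le_of_card_le {K : ℕ} (a : Fin K → ℕ) (ha : ∀ k, 0 < a k)
    (hlac : ∀ (k : ℕ) (hk : k + 1 < K), 8 * a ⟨k, by omega⟩ ≤ a ⟨k + 1, hk⟩)
    {N : ℕ} [NeZero N] (hN : ∀ k, 6 * a k ≤ N) {S T : Finset (ZMod N)}
    (hST : (S ∪ T : Set (ZMod N)) = generators N a) (hdisj : Disjoint S T)
    (hS : IsSymmetricSet (S : Set (ZMod N))) (hpos : 0 < S.card) (hcard : T.card ≤ S.card)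
    {ε : ℝ} (hε0 : 0 ≤ ε) (hε : ε < 1 / 4) :
    ¬ laplacian (SimpleGraph.circulantGraph (S : Set (ZMod N))) ≤
      (1 / 2 + ε) • laplacian (SimpleGraph.circulantGraph (generators N a)) := by
  intro hle
  obtain ⟨ψ, hψ⟩ := exists_addChar_separating a ha hlac hN hS
  have hC := isSymmetricSet_generators N a
  rw [← hST, ← Finset.coe_union] at hle hC
  have hsum := sum_one_sub_re_le_of_laplacian_le hS hC hle ψ
  rw [Finset.sum_union hdisj] at hsum
  have hlow : S.card * (3 / 2 : ℝ) ≤ ∑ s ∈ S, (1 - (ψ s).re) := by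
    rw [← nsmul_eq_mul]
    refine Finset.card_nsmul_le_sum _ _ _ fun s hs => ?_
    have := (hψ s (hST ▸ Or.inl hs)).1 hs
    linarith
  have hupp : ∑ s ∈ T, (1 - (ψ s).re) ≤ T.card * (1 / 2 : ℝ) := by
    rw [← nsmul_eq_mul]
    refine Finset.sum_le_card_nsmul _ _ _ fun s hs => ?_
    have := (hψ s (hST ▸ Or.inr hs)).2 (Finset.disjoint_right.mp hdisj hs)
    linarith
  have hpos' : (0 : ℝ) < S.card := by exact_mod_cast hpos
  have hcard' : (T.card : ℝ) ≤ S.card := by exact_mod_cast hcard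
  nlinarith

theorem le_card_of_coe_eq_generators {K : ℕ} {a : Fin K → ℕ} (hinj : Function.Injective a) {N : ℕ}
    (hN : ∀ k, a k < N) {C : Finset (ZMod N)} (hC : (C : Set (ZMod N)) = generators N a) :
    K ≤ C.card := by
  classical
  have himg : Finset.univ.image (fun k => (a k : ZMod N)) ⊆ C := by
    intro x hx
    obtain ⟨k, -, rfl⟩ := Finset.mem_image.mp hx
    rw [← Finset.mem_coe, hC]
    exact ⟨k, Or.inl rfl⟩
  have hcard := Finset.card_le_card himg
  rwa [Finset.card_image_of_injective, Finset.card_univ, Fintype.card_fin] at hcard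
  intro k l hkl
  exact hinj (((ZMod.natCast_eq_natCast_iff _ _ _).mp hkl).eq_of_lt_of_lt (hN k) (hN l))

end CirculantLower

open CirculantLower in
theorem mainTheorem3 :
    ∃ (c : ℝ) (K₀ : ℕ) (h : (K : ℕ) → (Fin K → ℕ) → ℕ), 0 < c ∧
      ∀ (K : ℕ), K₀ < K →
      ∀ (a : Fin K → ℕ), (∀ k, 0 < a k) →
      (∀ k : Fin K, 0 < (k : ℕ) →
        4 * Real.logb 6 (K : ℝ) < (a k : ℝ) / ∑ j ∈ Finset.Iio k, (a j : ℝ)) →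
      ∀ (N : ℕ) [NeZero N], h K a < N →
      AddSubgroup.closure (CirculantLower.generators N a) = ⊤ →
      ¬ ∃ C₁ C₂ : Set (ZMod N),
        C₁ ∪ C₂ = CirculantLower.generators N a ∧ Disjoint C₁ C₂ ∧
        CirculantLower.IsSymmetricSet C₁ ∧ CirculantLower.IsSymmetricSet C₂ ∧
        ∀ Cᵢ ∈ ({C₁, C₂} : Set (Set (ZMod N))),
          CirculantLower.HalfApproximates
            (SimpleGraph.circulantGraph Cᵢ)
            (SimpleGraph.circulantGraph (CirculantLower.generators N a))
            (c * √(CirculantLower.maxEdgeResistance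
                (SimpleGraph.circulantGraph (CirculantLower.generators N a)) *
              Real.logb 6 (K : ℝ))) := by
  -- `K > 36` makes the growth factor `4 * log₆ K` at least `8`; since `α * log₆ K ≤ 18 < 5 ^ 2`,
  -- the choice `c = 1 / 25` keeps the approximation error below `1 / 5 < 1 / 4`
  refine ⟨1 / 25, 36, fun _ a => 6 * ∑ k, a k, by norm_num, ?_⟩
  rintro K hK a ha hratio N _ hN - ⟨C₁, C₂, hunion, hdisj, hsymm₁, hsymm₂, happrox⟩
  have hK36 : (36 : ℝ) < K := by exact_mod_cast hK
  have hlog2 : 2 ≤ Real.logb 6 K := by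
    rw [Real.le_logb_iff_rpow_le (by norm_num) (by linarith)]
    norm_num
    linarith
  have hlogK : Real.logb 6 K ≤ K := by
    rw [Real.logb_le_iff_le_rpow (by norm_num) (by linarith), Real.rpow_natCast]
    exact_mod_cast (Nat.lt_pow_self (by norm_num : 1 < 6)).le
  have hlac : ∀ (k : ℕ) (hk : k + 1 < K), 8 * a ⟨k, by omega⟩ ≤ a ⟨k + 1, hk⟩ := by
    intro k hk
    have h1 := hratio ⟨k + 1, hk⟩ (Nat.succ_pos k)
    have hmem : (⟨k, by omega⟩ : Fin K) ∈ Finset.Iio (⟨k + 1, hk⟩ : Fin K) := by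
      simp [Fin.lt_def]
    have h2 : (a ⟨k, by omega⟩ : ℝ) ≤ ∑ j ∈ Finset.Iio (⟨k + 1, hk⟩ : Fin K), (a j : ℝ) :=
      Finset.single_le_sum (f := fun j => (a j : ℝ)) (fun j _ => Nat.cast_nonneg _) hmem
    have h3 : (0 : ℝ) < a ⟨k, by omega⟩ := by exact_mod_cast ha _
    rw [lt_div_iff₀ (by linarith)] at h1
    have h4 : (8 : ℝ) * a ⟨k, by omega⟩ ≤ a ⟨k + 1, hk⟩ := by nlinarith
    exact_mod_cast h4
  have hNa : ∀ k, 6 * a k ≤ N := fun k =>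
    (Nat.mul_le_mul_left 6 (Finset.single_le_sum (fun _ _ => Nat.zero_le _)
      (Finset.mem_univ k))).trans hN.le
  have hmono : StrictMono a := by
    obtain ⟨n, rfl⟩ : ∃ n, K = n + 1 := ⟨K - 1, by omega⟩
    refine Fin.strictMono_iff_lt_succ.mpr fun i => ?_
    have h1 := hlac i (by omega)
    have h2 := ha i.castSucc
    change 8 * a i.castSucc ≤ a i.succ at h1
    omega
  classical
  lift C₁ to Finset (ZMod N) using Set.toFinite _
  lift C₂ to Finset (ZMod N) using Set.toFinite _
  rw [Finset.disjoint_coe] at hdisj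
  have hC : ((C₁ ∪ C₂ : Finset (ZMod N)) : Set (ZMod N)) = generators N a := by
    rw [Finset.coe_union, hunion]
  have hcard : K ≤ (C₁ ∪ C₂).card := le_card_of_coe_eq_generators hmono.injective
    (fun k => by have := hNa k; have := ha k; omega) hC
  set ε := 1 / 25 * √(maxEdgeResistance (SimpleGraph.circulantGraph (generators N a)) *
    Real.logb 6 (K : ℝ)) with hεdef
  have hε0 : 0 ≤ ε := by positivity
  have hε : ε < 1 / 4 := by
    have hα : maxEdgeResistance (SimpleGraph.circulantGraph (generators N a)) ≤
        18 / (C₁ ∪ C₂).card := by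
      rw [← hC]
      exact maxEdgeResistance_circulantGraph_le (hC ▸ isSymmetricSet_generators N a) (by omega)
    have hcard' : (K : ℝ) ≤ (C₁ ∪ C₂).card := by exact_mod_cast hcard
    have hprod : maxEdgeResistance (SimpleGraph.circulantGraph (generators N a)) *
        Real.logb 6 K ≤ 18 := by
      calc _ ≤ 18 / ((C₁ ∪ C₂).card : ℝ) * Real.logb 6 K := by gcongr
        _ ≤ 18 := by
          rw [div_mul_eq_mul_div, div_le_iff₀ (by linarith)]
          linarith
    have : √(maxEdgeResistance (SimpleGraph.circulantGraph (generators N a)) *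
        Real.logb 6 (K : ℝ)) ≤ 5 := Real.sqrt_le_iff.mpr ⟨by norm_num, by linarith⟩
    rw [hεdef]
    linarith
  rw [Finset.card_union_of_disjoint hdisj] at hcard
  rcases le_total C₂.card C₁.card with hle | hle
  · exact not_laplacian_le_of_card_le a ha hlac hNa hunion hdisj hsymm₁ (by omega) hle hε0 hε
      (happrox _ (by simp)).2
  · exact not_laplacian_le_of_card_le a ha hlac hNa (by rw [Set.union_comm, hunion]) hdisj.symm
      hsymm₂ (by omega) hle hε0 hε (happrox _ (by simp)).2
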